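/- Let $(\lambda_k)_{k\ge1}$ be a strictly increasing sequence of positive real numbers with $\lambda_k\sim k^2$, i.e. $\lambda_k/k^2\to1$ as $k\to\infty$. Let $H$ be a real separable Hilbert space with orthonormal basis $(e_k)_{k\ge1}$, and let $A$ be the self-adjoint operator with $Ae_k=-\lambda_ke_k$; for $\varphi:\mathbb R\to\mathbb R$ put $\varphi(A)x=\sum_k\varphi(-\lambda_k)\langle x,e_k\rangle e_k$ on the domain $\{x\in H:\sum_k\varphi(-\lambda_k)^2\langle x,e_k\rangle^2<\infty\}$; in particular $D((-A)^{1/2})=\{x\in H:\sum_k\lambda_k\langle x,e_k\rangle^2<\infty\}$. Let $\mu=N(0,(-2A)^{-1})$ be the centered Gaussian measure on $H$ with covariance operator $(-2A)^{-1}$, i.e. the law of $\sum_k\xi_ke_k$ with independent $\xi_k\sim N(0,1/(2\lambda_k))$. Let $C^2_b(H)$ be the space of bounded functions $f:H\to\mathbb R$ that are twice Fréchet differentiable with bounded and continuous first and second derivatives. For $f\in C_b^2(H)$ and $x\in H$ put $$P_tf(x)=\int_H f\big(e^{tA}x+\sqrt{I-e^{2tA}}\,y\big)\,\mu(dy)\quad(t\ge0),\qquad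 R(1,L)f(x)=\int_0^\infty e^{-t}P_tf(x)\,dt .$$ Then: 1. For every $f\in C^2_b(H)$ the function $R(1,L)f$ is Fréchet differentiable on $H$, and its gradient satisfies $D(R(1,L)f)(x)\in D((-A)^{1/2})$ for every $x\in H$. 2. $$\sup\big\{\,|(-A)^{1/2}D(R(1,L)f)(0)|_H \;:\; f\in C^2_b(H),\ \|f\|_\infty\le1\,\big\}=\infty .$$ 3. Consequently, there is no constant $C>0$ such that $$\sup_{x\in H}|(-A)^{1/2}D(R(1,L)f)(x)|_H\le C\,\sup_{x\in H}|f(x)|\qquad\text{for all } f\in C_b^2(H).$$ -/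

import Mathlib

open MeasureTheory ProbabilityTheory Filter Topology Asymptotics
open scoped ENNReal NNReal RealInnerProductSpace

namespace OUSemigroup

noncomputable section

section Spectral

variable {H : Type*} [NormedAddCommGroup H] [InnerProductSpace ℝ H]

/-- Let `A` be the self-adjoint operator with `A e_k = -lam_k e_k`.  For `φ : ℝ → ℝ` the operator
`φ(A)` is given by `φ(A) x = ∑_k φ(-lam_k) ⟨e_k, x⟩ e_k`, on the domain `specDomain e lam φ`
below.  (Off the domain the value is the meaningless `0`.) -/
def specFun (e : HilbertBasis ℕ ℝ H) (lam : ℕ → ℝ) (φ : ℝ → ℝ) (x : H) : H :=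
  ∑' k, (φ (-lam k) * ⟪e k, x⟫) • e k

/-- The domain of `φ(A)`: all `x` with `∑_k φ(-lam_k)² ⟨e_k, x⟩² < ∞`. -/
def specDomain (e : HilbertBasis ℕ ℝ H) (lam : ℕ → ℝ) (φ : ℝ → ℝ) : Set H :=
  {x | Summable fun k => (φ (-lam k) * ⟪e k, x⟫) ^ 2}

/-- The operator `e^{tA}`. -/
def expA (e : HilbertBasis ℕ ℝ H) (lam : ℕ → ℝ) (t : ℝ) : H → H :=
  specFun e lam fun a => Real.exp (t * a)

/-- The operator `√(I - e^{2tA})`, for `t ≥ 0`. -/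
def sqrtOneSubExpA (e : HilbertBasis ℕ ℝ H) (lam : ℕ → ℝ) (t : ℝ) : H → H :=
  specFun e lam fun a => Real.sqrt (1 - Real.exp (2 * t * a))

/-- The unbounded operator `(-A)^{1/2}`; it is meaningful on `domSqrtNegA e lam`. -/
def sqrtNegA (e : HilbertBasis ℕ ℝ H) (lam : ℕ → ℝ) : H → H :=
  specFun e lam fun a => Real.sqrt (-a)

/-- The domain `D((-A)^{1/2})`. -/
def domSqrtNegA (e : HilbertBasis ℕ ℝ H) (lam : ℕ → ℝ) : Set H :=
  specDomain e lam fun a => Real.sqrt (-a)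

/-- `(-2A)⁻¹`, the covariance operator of the invariant Gaussian measure. -/
def covOp (e : HilbertBasis ℕ ℝ H) (lam : ℕ → ℝ) : H → H :=
  specFun e lam fun a => (-(2 * a))⁻¹

/-- The space `C²_b(H)`: bounded functions with two bounded, continuous Fréchet derivatives. -/
structure IsCbTwo (f : H → ℝ) : Prop where
  contDiff : ContDiff ℝ 2 f
  bounded : ∃ C : ℝ, ∀ x, |f x| ≤ C
  bounded_fderiv : ∃ C : ℝ, ∀ x, ‖fderiv ℝ f x‖ ≤ C
  bounded_fderiv_fderiv : ∃ C : ℝ, ∀ x, ‖fderiv ℝ (fderiv ℝ f) x‖ ≤ C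

/-- The centered Gaussian measure `N(0, -(2A)⁻¹)` on `H`: the law of `∑_k ξ_k e_k` with
independent `ξ_k ∼ N(0, 1 / (2 lam_k))`. -/
def gaussianMeasure [MeasurableSpace H] (e : HilbertBasis ℕ ℝ H) (lam : ℕ → ℝ) : Measure H :=
  (Measure.infinitePi fun k => gaussianReal 0 (Real.toNNReal (1 / (2 * lam k)))).map
    fun ξ : ℕ → ℝ => ∑' k, ξ k • e k

/-- The Ornstein–Uhlenbeck semigroup
`P_t f(x) = ∫ f(e^{tA} x + √(I - e^{2tA}) y) N(0, -(2A)⁻¹)(dy)`. -/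
def ouSemigroup [MeasurableSpace H] (e : HilbertBasis ℕ ℝ H) (lam : ℕ → ℝ) (t : ℝ) (f : H → ℝ)
    (x : H) : ℝ :=
  ∫ y, f (expA e lam t x + sqrtOneSubExpA e lam t y) ∂(gaussianMeasure e lam)

/-- The resolvent `R(1, L) f(x) = ∫_0^∞ e^{-t} P_t f(x) dt`. -/
def resolventOne [MeasurableSpace H] (e : HilbertBasis ℕ ℝ H) (lam : ℕ → ℝ) (f : H → ℝ)
    (x : H) : ℝ :=
  ∫ t in Set.Ioi (0 : ℝ), Real.exp (-t) * ouSemigroup e lam t f x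

end Spectral

section Gaussian

/-! The measure above is the centered Gaussian measure with covariance operator `(-2A)⁻¹`. -/

variable {H : Type*} [NormedAddCommGroup H] [InnerProductSpace ℝ H]

theorem summable_smul_basis [CompleteSpace H] (e : HilbertBasis ℕ ℝ H) {a : ℕ → ℝ}
    (ha : Summable fun k => a k ^ 2) : Summable fun k => a k • e k := by
  have h := (e.orthonormal.orthogonalFamily).summable_iff_norm_sq_summable (f := a)
  simp only [LinearIsometry.toSpanSingleton_apply, Real.norm_eq_abs, sq_abs] at h
  exact h.2 ha

theorem ae_summable_sq {lam : ℕ → ℝ} (hsum : Summable fun k => 1 / lam k) :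
    ∀ᵐ ξ ∂(Measure.infinitePi fun k => gaussianReal 0 (Real.toNNReal (1 / (2 * lam k)))),
      Summable fun k => ξ k ^ 2 := by
  set P := Measure.infinitePi fun k => gaussianReal 0 (Real.toNNReal (1 / (2 * lam k)))
  have hm : ∀ k, Measurable fun ξ : ℕ → ℝ => ENNReal.ofReal (ξ k ^ 2) := fun k => by fun_prop
  have hint : ∀ k, ∫⁻ ξ, ENNReal.ofReal (ξ k ^ 2) ∂P = Real.toNNReal (1 / (2 * lam k)) := by
    intro k
    have hP := Measure.infinitePi_map_eval
      (fun k => gaussianReal 0 (Real.toNNReal (1 / (2 * lam k)))) k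
    have h1 : ∫⁻ ξ, ENNReal.ofReal (ξ k ^ 2) ∂P
        = ∫⁻ x, ENNReal.ofReal (x ^ 2) ∂(P.map (fun ξ => ξ k)) := by
      rw [lintegral_map (by fun_prop) (by fun_prop)]
    rw [h1, hP, ← ofReal_integral_eq_lintegral_ofReal]
    · have hv := variance_fun_id_gaussianReal (μ := 0) (v := Real.toNNReal (1 / (2 * lam k)))
      rw [variance_of_integral_eq_zero (by fun_prop) (by simp)] at hv
      rw [hv, ENNReal.ofReal, Real.toNNReal_coe]
    · simpa using (memLp_id_gaussianReal' (μ := 0)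
        (v := Real.toNNReal (1 / (2 * lam k))) 2 (by simp)).integrable_sq
    · exact ae_of_all _ fun x => sq_nonneg x
  have hs : Summable fun k => Real.toNNReal (1 / (2 * lam k)) := by
    refine Summable.toNNReal ?_
    refine (hsum.mul_left (1 / 2)).congr fun k => ?_
    rw [one_div_mul_one_div]
  have hfin : ∫⁻ ξ, ∑' k, ENNReal.ofReal (ξ k ^ 2) ∂P ≠ ∞ := by
    rw [lintegral_tsum fun k => (hm k).aemeasurable]
    simp_rw [hint]
    exact ENNReal.tsum_coe_ne_top_iff_summable.2 hs
  filter_upwards [ae_lt_top (by fun_prop) hfin] with ξ hξ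
  have := ENNReal.summable_toReal hξ.ne
  exact this.congr fun k => ENNReal.toReal_ofReal (sq_nonneg _)

theorem ae_tendsto_partial [CompleteSpace H] (e : HilbertBasis ℕ ℝ H) {lam : ℕ → ℝ}
    (hsum : Summable fun k => 1 / lam k) :
    ∀ᵐ ξ ∂(Measure.infinitePi fun k => gaussianReal 0 (Real.toNNReal (1 / (2 * lam k)))),
      Tendsto (fun n => ∑ k ∈ Finset.range n, ξ k • e k) atTop (𝓝 (∑' k, ξ k • e k)) := by
  filter_upwards [ae_summable_sq hsum] with ξ hξ
  exact (summable_smul_basis e hξ).hasSum.tendsto_sum_nat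

theorem aemeasurable_series [CompleteSpace H] [MeasurableSpace H] [BorelSpace H]
    (e : HilbertBasis ℕ ℝ H) {lam : ℕ → ℝ} (hsum : Summable fun k => 1 / lam k) :
    AEMeasurable (fun ξ : ℕ → ℝ => ∑' k, ξ k • e k)
      (Measure.infinitePi fun k => gaussianReal 0 (Real.toNNReal (1 / (2 * lam k)))) := by
  refine aemeasurable_of_tendsto_metrizable_ae atTop (fun n => ?_) (ae_tendsto_partial e hsum)
  have : Continuous fun ξ : ℕ → ℝ => ∑ k ∈ Finset.range n, ξ k • e k := by fun_prop
  exact this.measurable.aemeasurable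

theorem isProbabilityMeasure_gaussianMeasure [CompleteSpace H] [MeasurableSpace H] [BorelSpace H]
    (e : HilbertBasis ℕ ℝ H) {lam : ℕ → ℝ} (hsum : Summable fun k => 1 / lam k) :
    IsProbabilityMeasure (gaussianMeasure e lam) :=
  Measure.isProbabilityMeasure_map (aemeasurable_series e hsum)

theorem charFun_partial (lam c : ℕ → ℝ) (n : ℕ) :
    ∫ ξ : ℕ → ℝ, Complex.exp ((∑ k ∈ Finset.range n, c k * ξ k : ℝ) * Complex.I)
      ∂(Measure.infinitePi fun k => gaussianReal 0 (Real.toNNReal (1 / (2 * lam k))))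
    = Complex.exp (-(∑ k ∈ Finset.range n, Real.toNNReal (1 / (2 * lam k)) * c k ^ 2 : ℝ) / 2) := by
  set P := Measure.infinitePi fun k => gaussianReal 0 (Real.toNNReal (1 / (2 * lam k)))
  have hmk : ∀ k, Measurable fun ξ : ℕ → ℝ => c k * ξ k :=
    fun k => (show Measurable fun ξ : ℕ → ℝ => ξ k from measurable_pi_apply k).const_mul (c k)
  have hind : iIndepFun (fun k (ξ : ℕ → ℝ) => c k * ξ k) P :=
    iIndepFun_infinitePi (X := fun k x => c k * x) (by fun_prop)
  have h := iIndepFun.charFun_map_fun_finsetSum_eq_prod (s := Finset.range n)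
    (X := fun k (ξ : ℕ → ℝ) => c k * ξ k) (P := P)
    (fun k _ => (hmk k).aemeasurable) (hind.restrict _)
  have h1 := congrFun h 1
  rw [charFun_apply_real, integral_map
    (Finset.measurable_fun_sum _ fun k _ => hmk k).aemeasurable (by fun_prop)] at h1
  simp only [Complex.ofReal_one, one_mul, Finset.prod_apply] at h1
  rw [h1]
  have hk : ∀ k, charFun (P.map fun ξ : ℕ → ℝ => c k * ξ k) 1
      = Complex.exp (-(Real.toNNReal (1 / (2 * lam k)) * c k ^ 2 : ℝ) / 2) := by
    intro k
    have hP : P.map (fun ξ => ξ k) = gaussianReal 0 (Real.toNNReal (1 / (2 * lam k))) :=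
      Measure.infinitePi_map_eval _ k
    have : P.map (fun ξ : ℕ → ℝ => c k * ξ k)
        = (P.map (fun ξ => ξ k)).map (fun x => c k * x) := by
      rw [Measure.map_map (by fun_prop) (by fun_prop)]; rfl
    rw [this, hP, gaussianReal_map_const_mul, charFun_gaussianReal]
    congr 1
    simp
    ring
  rw [Finset.prod_congr rfl fun k _ => hk k, ← Complex.exp_sum]
  congr 1
  push_cast
  rw [neg_div, Finset.sum_div, ← Finset.sum_neg_distrib]
  exact Finset.sum_congr rfl fun k _ => by ring

/-- `gaussianMeasure e lam` has the characteristic functional of `N(0, (-2A)⁻¹)`, namely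
`h ↦ exp (-⟨(-2A)⁻¹ h, h⟩ / 2)`, which determines a probability measure on `H`. -/
theorem charFun_gaussianMeasure [CompleteSpace H] [MeasurableSpace H] [BorelSpace H]
    (e : HilbertBasis ℕ ℝ H) {lam : ℕ → ℝ} (hpos : ∀ k, 0 < lam k)
    (hsum : Summable fun k => 1 / lam k) (h : H) :
    ∫ x, Complex.exp (⟪x, h⟫ * Complex.I) ∂(gaussianMeasure e lam)
      = Complex.exp (-(⟪covOp e lam h, h⟫ : ℝ) / 2) := by
  set P := Measure.infinitePi fun k => gaussianReal 0 (Real.toNNReal (1 / (2 * lam k))) with hPdef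
  have hL : Tendsto (fun n => ∫ ξ : ℕ → ℝ,
      Complex.exp ((∑ k ∈ Finset.range n, ⟪e k, h⟫ * ξ k : ℝ) * Complex.I) ∂P) atTop
      (𝓝 (∫ x, Complex.exp (⟪x, h⟫ * Complex.I) ∂(gaussianMeasure e lam))) := by
    have hcont : Continuous fun x : H => Complex.exp ((⟪x, h⟫ : ℝ) * Complex.I) := by fun_prop
    have hsm : AEStronglyMeasurable (fun x : H => Complex.exp ((⟪x, h⟫ : ℝ) * Complex.I))
        (gaussianMeasure e lam) := hcont.measurable.aestronglyMeasurable
    rw [gaussianMeasure, integral_map (aemeasurable_series e hsum) hsm]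
    refine tendsto_integral_of_dominated_convergence (fun _ => 1) (fun n => ?_)
      (integrable_const _) (fun n => ?_) ?_
    · have : Continuous fun ξ : ℕ → ℝ =>
          Complex.exp ((∑ k ∈ Finset.range n, ⟪e k, h⟫ * ξ k : ℝ) * Complex.I) := by fun_prop
      exact this.measurable.aestronglyMeasurable
    · exact ae_of_all _ fun ξ => (Complex.norm_exp_ofReal_mul_I _).le
    · filter_upwards [ae_tendsto_partial e hsum] with ξ hξ
      have := (hcont.tendsto _).comp hξ
      refine this.congr fun n => ?_
      simp only [Function.comp_apply, sum_inner, real_inner_smul_left]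
      congr 3
      exact Finset.sum_congr rfl fun k _ => mul_comm _ _
  have hcov : HasSum (fun k => (Real.toNNReal (1 / (2 * lam k)) : ℝ) * ⟪e k, h⟫ ^ 2)
      ⟪covOp e lam h, h⟫ := by
    have hd : ∀ k, ((-(2 * -lam k))⁻¹ : ℝ) = Real.toNNReal (1 / (2 * lam k)) := by
      intro k
      rw [Real.coe_toNNReal _ (by have := hpos k; positivity)]
      simp
    have hbase : Summable fun k => ⟪e k, h⟫ ^ 2 := by
      refine (e.summable_inner_mul_inner h h).congr fun k => ?_
      rw [real_inner_comm, sq]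
    have hb0 : Tendsto (fun k => (Real.toNNReal (1 / (2 * lam k)) : ℝ)) atTop (𝓝 0) := by
      have := (hsum.mul_left (1 / 2)).tendsto_atTop_zero
      refine this.congr fun k => ?_
      rw [Real.coe_toNNReal _ (by have := hpos k; positivity), one_div_mul_one_div]
    obtain ⟨C, hC⟩ := hb0.bddAbove_range
    have hC' : ∀ k, (Real.toNNReal (1 / (2 * lam k)) : ℝ) ≤ C := fun k => hC ⟨k, rfl⟩
    have hs : Summable fun k => ((-(2 * -lam k))⁻¹ * ⟪e k, h⟫) • e k := by
      refine summable_smul_basis e ?_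
      refine Summable.of_nonneg_of_le (fun k => sq_nonneg _) (fun k => ?_)
        (hbase.mul_left (C ^ 2))
      rw [hd, mul_pow]
      have := hC' k
      gcongr
    have h1 := hs.hasSum.mapL (innerSL ℝ h)
    have h2 : ⟪covOp e lam h, h⟫ = innerSL ℝ h (∑' k, ((-(2 * -lam k))⁻¹ * ⟪e k, h⟫) • e k) := by
      rw [innerSL_apply_apply, real_inner_comm]; rfl
    rw [h2]
    refine h1.congr_fun fun k => ?_
    rw [innerSL_apply_apply, real_inner_smul_right, hd, real_inner_comm]
    ring
  have hR := fun n => charFun_partial lam (fun k => ⟪e k, h⟫) n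
  refine tendsto_nhds_unique hL ?_
  simp_rw [hPdef, hR]
  have := hcov.tendsto_sum_nat
  have hc : Continuous fun r : ℝ => Complex.exp (-(r : ℂ) / 2) := by fun_prop
  exact (hc.tendsto _).comp this

/-- On the basis, `φ(A)` acts by `φ(A) e_j = φ(-lam_j) e_j`. -/
theorem specFun_basis (e : HilbertBasis ℕ ℝ H) (lam : ℕ → ℝ) (φ : ℝ → ℝ) (j : ℕ) :
    specFun e lam φ (e j) = φ (-lam j) • e j := by
  have h := e.orthonormal
  rw [specFun, tsum_eq_single j]
  · simp [h.1 j]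
  · intro k hk
    simp [h.2 hk]

end Gaussian

end

end OUSemigroup

/-! Let v(t) be the mean of Df under the law at time t of the Ornstein–Uhlenbeck process started at
x (`meanGradient`). Differentiating under both integrals gives D(R(1,L)f)(x) = ∫ e^{-t} e^{tA} v(t)
dt (`hasGradientAt_resolventOne`). Its k-th coordinate G_k is a Laplace integral against e^{-tλ_k},
whose L² norm in t is (2λ_k)^{-1/2}; so λ_k G_k² is controlled by ∫ e^{-2t} v_k(t)² dt, and these
bounds sum because |v(t)| ≤ sup |Df|. This puts the gradient in D((-A)^{1/2}), but the bound
involves Df rather than f.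

For the blow-up, note that sin(√λ_k x_k) is bounded by 1 and yields √λ_k G_k of order 1 at the
origin, already from times t ∈ [1/λ_k, 2/λ_k]. A sum of n such oscillations would give a vector of
norm of order √n, if its sup norm could be kept at 1. For this the j-th oscillation is made active
only near its own time scale. A function of x can detect time because infinitely many coordinates
are available: the product `cutoff` over the first m even coordinates has mean `level lam m t` when
started at 0, which tends to 1 as t → 0 with m fixed and to 0 as m → ∞ with t > 0 fixed. Differences
of successive cutoffs are nonnegative and telescope, so using them as weights keeps |f| ≤ 1
(`abs_testFun_le_one`). Choosing cutoffs and odd frequencies alternately (`exists_scales`) makes the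
j-th weight have mean at least 1/2 on the j-th time interval. Oscillations live in odd coordinates,
independent of the cutoffs, so means factorize (`integral_cutoff_mul_cos`), and each of n orthogonal
coordinates contributes at least a fixed c > 0 (`mul_level_sub_le_integral`). -/

namespace OUSemigroup

noncomputable section

/-! ### Diagonal contractions and their strong continuity -/

section Diagonal

variable {H : Type*} [NormedAddCommGroup H] [InnerProductSpace ℝ H]

theorem hasSum_inner_basis_sq (e : HilbertBasis ℕ ℝ H) (x : H) :
    HasSum (fun k => ⟪e k, x⟫ ^ 2) (‖x‖ ^ 2) := by
  have h := e.hasSum_inner_mul_inner x x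
  rw [real_inner_self_eq_norm_sq] at h
  refine h.congr_fun fun k => ?_
  rw [real_inner_comm x, sq]

theorem summable_mul_inner_sq (e : HilbertBasis ℕ ℝ H) {c : ℕ → ℝ} {C : ℝ} (hc : ∀ k, |c k| ≤ C)
    (x : H) : Summable fun k => (c k * ⟪e k, x⟫) ^ 2 := by
  refine Summable.of_nonneg_of_le (fun k => sq_nonneg _) (fun k => ?_)
    ((hasSum_inner_basis_sq e x).summable.mul_left (C ^ 2))
  rw [mul_pow]
  have := sq_le_sq' (abs_le.1 (hc k)).1 (abs_le.1 (hc k)).2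
  gcongr

theorem inner_basis_tsum [CompleteSpace H] (e : HilbertBasis ℕ ℝ H) {a : ℕ → ℝ} (ha : Summable fun k => a k ^ 2)
    (j : ℕ) : ⟪e j, ∑' k, a k • e k⟫ = a j := by
  have h := (summable_smul_basis e ha).hasSum.mapL (innerSL ℝ (e j))
  have h2 : HasSum (fun k => innerSL ℝ (e j) (a k • e k)) (a j) := by
    convert hasSum_single j ?_ using 1
    · simp [e.orthonormal.1 j]
    · intro k hk
      simp [e.orthonormal.2 hk.symm]
  simpa using h.unique h2

theorem ext_inner_basis (e : HilbertBasis ℕ ℝ H) {x y : H} (h : ∀ k, ⟪e k, x⟫ = ⟪e k, y⟫) :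
    x = y := by
  have := hasSum_inner_basis_sq e (x - y)
  simp only [inner_sub_right, h, sub_self, ne_eq, OfNat.ofNat_ne_zero, not_false_eq_true,
    zero_pow] at this
  have h0 := this.unique hasSum_zero
  rw [sq_eq_zero_iff, norm_eq_zero, sub_eq_zero] at h0
  exact h0

variable [CompleteSpace H]

/-- The diagonal contraction with multipliers `c`. -/
def diagCLM (e : HilbertBasis ℕ ℝ H) (c : ℕ → ℝ) (hc : ∀ k, |c k| ≤ 1) : H →L[ℝ] H :=
  LinearMap.mkContinuous
    { toFun := fun x => ∑' k, (c k * ⟪e k, x⟫) • e k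
      map_add' := fun x y => ext_inner_basis e fun k => by
        rw [inner_add_right, inner_basis_tsum e (summable_mul_inner_sq e hc _),
          inner_basis_tsum e (summable_mul_inner_sq e hc _),
          inner_basis_tsum e (summable_mul_inner_sq e hc _), inner_add_right, mul_add]
      map_smul' := fun r x => ext_inner_basis e fun k => by
        rw [RingHom.id_apply, real_inner_smul_right,
          inner_basis_tsum e (summable_mul_inner_sq e hc _),
          inner_basis_tsum e (summable_mul_inner_sq e hc _), real_inner_smul_right]
        ring } 1
    fun x => by
      rw [one_mul, ← sq_le_sq₀ (norm_nonneg _) (norm_nonneg _)]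
      refine hasSum_le (fun k => ?_) (hasSum_inner_basis_sq e _) (hasSum_inner_basis_sq e x)
      simp only [LinearMap.coe_mk, AddHom.coe_mk]
      rw [inner_basis_tsum e (summable_mul_inner_sq e hc _), mul_pow]
      exact mul_le_of_le_one_left (sq_nonneg _) ((sq_le_one_iff_abs_le_one _).2 (hc k))

variable {e : HilbertBasis ℕ ℝ H} {c : ℕ → ℝ} (hc : ∀ k, |c k| ≤ 1)

theorem diagCLM_apply (x : H) : diagCLM e c hc x = ∑' k, (c k * ⟪e k, x⟫) • e k := rfl

theorem norm_diagCLM_le : ‖diagCLM e c hc‖ ≤ 1 :=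
  LinearMap.mkContinuous_norm_le _ zero_le_one _

theorem norm_diagCLM_apply_le (x : H) : ‖diagCLM e c hc x‖ ≤ ‖x‖ := by
  simpa using (diagCLM e c hc).le_of_opNorm_le (norm_diagCLM_le hc) x

theorem inner_basis_diagCLM (k : ℕ) (x : H) : ⟪e k, diagCLM e c hc x⟫ = c k * ⟪e k, x⟫ := by
  rw [diagCLM_apply, inner_basis_tsum e (summable_mul_inner_sq e hc _)]

theorem inner_diagCLM_comm (x y : H) : ⟪diagCLM e c hc x, y⟫ = ⟪x, diagCLM e c hc y⟫ := by
  rw [← e.tsum_inner_mul_inner, ← e.tsum_inner_mul_inner]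
  congr 1
  ext k
  rw [real_inner_comm, inner_basis_diagCLM, inner_basis_diagCLM, real_inner_comm x]
  ring

/-- Dominated convergence in Parseval's sum: two multipliers differ by at most 2. -/
theorem continuous_diagCLM_apply {c : ℝ → ℕ → ℝ} (hc : ∀ t k, |c t k| ≤ 1)
    (hcont : ∀ k, Continuous fun t => c t k) (x : H) :
    Continuous fun t => diagCLM e (c t) (hc t) x := by
  rw [continuous_iff_continuousAt]
  intro t₀
  rw [ContinuousAt, tendsto_iff_norm_sub_tendsto_zero]
  have key : ∀ t, ‖diagCLM e (c t) (hc t) x - diagCLM e (c t₀) (hc t₀) x‖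
      = √(∑' k, ((c t k - c t₀ k) * ⟪e k, x⟫) ^ 2) := by
    intro t
    rw [← Real.sqrt_sq (norm_nonneg _), ← (hasSum_inner_basis_sq e _).tsum_eq]
    congr 2
    ext k
    rw [inner_sub_right, inner_basis_diagCLM, inner_basis_diagCLM]
    ring
  simp_rw [key]
  rw [← Real.sqrt_zero]
  refine (Real.continuous_sqrt.tendsto 0).comp ?_
  have h0 : (0 : ℝ) = ∑' k : ℕ, ((c t₀ k - c t₀ k) * ⟪e k, x⟫) ^ 2 := by simp
  rw [h0]
  refine tendsto_tsum_of_dominated_convergence (bound := fun k => 2 ^ 2 * ⟪e k, x⟫ ^ 2)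
    ((hasSum_inner_basis_sq e x).summable.mul_left _) (fun k => ?_)
    (Eventually.of_forall fun t k => ?_)
  · have : Continuous fun t => ((c t k - c t₀ k) * ⟪e k, x⟫) ^ 2 := by
      have := hcont k
      fun_prop
    exact this.tendsto t₀
  · rw [Real.norm_of_nonneg (sq_nonneg _), mul_pow]
    have h1 := abs_le.1 (hc t k)
    have h2 := abs_le.1 (hc t₀ k)
    have := sq_le_sq' (a := c t k - c t₀ k) (b := 2) (by linarith) (by linarith)
    gcongr

/-- Split the argument as (w t - w t₀) + w t₀: contractivity handles the first term, strong
continuity the second. Norm continuity of the operators is not needed. -/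
theorem continuous_diagCLM_apply_comp {c : ℝ → ℕ → ℝ} (hc : ∀ t k, |c t k| ≤ 1)
    (hcont : ∀ k, Continuous fun t => c t k) {w : ℝ → H} (hw : Continuous w) :
    Continuous fun t => diagCLM e (c t) (hc t) (w t) := by
  rw [continuous_iff_continuousAt]
  intro t₀
  have h1 : Tendsto (fun t => diagCLM e (c t) (hc t) (w t - w t₀)) (𝓝 t₀) (𝓝 0) := by
    refine squeeze_zero_norm (fun t => norm_diagCLM_apply_le (hc t) _) ?_
    exact tendsto_iff_norm_sub_tendsto_zero.1 (hw.tendsto t₀)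
  have h2 := h1.add ((continuous_diagCLM_apply (e := e) hc hcont (w t₀)).tendsto t₀)
  rw [zero_add] at h2
  exact h2.congr fun t => by rw [← map_add, sub_add_cancel]

end Diagonal

/-! ### The operators e^{tA} and √(I - e^{2tA}) as contractions -/

section Semigroup

variable {lam : ℕ → ℝ}

/-- Using |t| in place of t extends the families to contractions for every real t, continuous in t;
only t ≥ 0 matters for the semigroup. -/
theorem abs_exp_neg_abs_mul_le_one (hpos : ∀ k, 0 < lam k) (t : ℝ) (k : ℕ) :
    |Real.exp (-(|t| * lam k))| ≤ 1 := by
  rw [abs_of_pos (Real.exp_pos _), Real.exp_le_one_iff]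
  have := mul_nonneg (abs_nonneg t) (hpos k).le
  linarith

theorem abs_sqrt_one_sub_exp_le_one (t : ℝ) (k : ℕ) :
    |√(1 - Real.exp (-(2 * (|t| * lam k))))| ≤ 1 := by
  rw [abs_of_nonneg (Real.sqrt_nonneg _), Real.sqrt_le_one]
  linarith [Real.exp_pos (-(2 * (|t| * lam k)))]

variable {H : Type*} [NormedAddCommGroup H] [InnerProductSpace ℝ H] [CompleteSpace H]
  (e : HilbertBasis ℕ ℝ H) (hpos : ∀ k, 0 < lam k)

/-- The contraction `e^{|t|A}`. -/
def expCLM (t : ℝ) : H →L[ℝ] H :=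
  diagCLM e (fun k => Real.exp (-(|t| * lam k))) (abs_exp_neg_abs_mul_le_one hpos t)

variable (lam) in
/-- The contraction `√(I - e^{2|t|A})`. -/
def sqrtCLM (t : ℝ) : H →L[ℝ] H :=
  diagCLM e (fun k => √(1 - Real.exp (-(2 * (|t| * lam k))))) (abs_sqrt_one_sub_exp_le_one t)

theorem expA_eq_expCLM {t : ℝ} (ht : 0 ≤ t) (x : H) : expA e lam t x = expCLM e hpos t x := by
  rw [expCLM, diagCLM_apply, expA, specFun, abs_of_nonneg ht]
  simp

theorem sqrtOneSubExpA_eq_sqrtCLM {t : ℝ} (ht : 0 ≤ t) (x : H) :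
    sqrtOneSubExpA e lam t x = sqrtCLM lam e t x := by
  rw [sqrtCLM, diagCLM_apply, sqrtOneSubExpA, specFun, abs_of_nonneg ht]
  simp [mul_assoc]

theorem norm_expCLM_apply_le (t : ℝ) (x : H) : ‖expCLM e hpos t x‖ ≤ ‖x‖ :=
  norm_diagCLM_apply_le _ x

theorem inner_basis_expCLM {t : ℝ} (ht : 0 ≤ t) (k : ℕ) (x : H) :
    ⟪e k, expCLM e hpos t x⟫ = Real.exp (-(t * lam k)) * ⟪e k, x⟫ := by
  rw [expCLM, inner_basis_diagCLM, abs_of_nonneg ht]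

theorem inner_basis_sqrtCLM {t : ℝ} (ht : 0 ≤ t) (k : ℕ) (x : H) :
    ⟪e k, sqrtCLM lam e t x⟫ = √(1 - Real.exp (-(2 * (t * lam k)))) * ⟪e k, x⟫ := by
  rw [sqrtCLM, inner_basis_diagCLM, abs_of_nonneg ht]

theorem continuous_expCLM_comp {w : ℝ → H} (hw : Continuous w) :
    Continuous fun t => expCLM e hpos t (w t) :=
  continuous_diagCLM_apply_comp _ (fun k => by fun_prop) hw

variable (lam) in
theorem continuous_sqrtCLM_comp {w : ℝ → H} (hw : Continuous w) :
    Continuous fun t => sqrtCLM lam e t (w t) :=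
  continuous_diagCLM_apply_comp _ (fun k => by fun_prop) hw

end Semigroup

/-! ### The two consequences of λ_k ∼ k²: divergence of λ_k and summability of 1/λ_k -/

section Growth

variable {lam : ℕ → ℝ}

theorem tendsto_atTop_of_isEquivalent_sq (hlam : lam ~[atTop] fun k : ℕ => ((k : ℝ) + 1) ^ 2) :
    Tendsto lam atTop atTop := by
  refine hlam.symm.tendsto_atTop ?_
  exact (tendsto_pow_atTop two_ne_zero).comp
    (tendsto_atTop_add_const_right _ _ tendsto_natCast_atTop_atTop)

theorem summable_one_div_of_isEquivalent_sq
    (hlam : lam ~[atTop] fun k : ℕ => ((k : ℝ) + 1) ^ 2) : Summable fun k => 1 / lam k := by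
  have h := hlam.inv.isBigO
  have h1 : Summable fun k : ℕ => (((k : ℝ) + 1) ^ 2)⁻¹ := by
    have := (summable_nat_add_iff 1).2 (Real.summable_nat_pow_inv.2 one_lt_two)
    simpa using this
  refine (summable_of_isBigO_nat h1 h).congr fun k => ?_
  rw [Pi.inv_apply, one_div]

end Growth

/-! ### Gradient of the resolvent and its membership in D((-A)^{1/2}) -/

section Gradient

variable {H : Type*} [NormedAddCommGroup H] [InnerProductSpace ℝ H] [CompleteSpace H]

omit [CompleteSpace H] in
theorem IsCbTwo.differentiable {f : H → ℝ} (hf : IsCbTwo f) : Differentiable ℝ f :=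
  hf.contDiff.differentiable (by norm_num)

theorem IsCbTwo.continuous_gradient {f : H → ℝ} (hf : IsCbTwo f) : Continuous (gradient f) :=
  (InnerProductSpace.toDual ℝ H).symm.continuous.comp (hf.contDiff.continuous_fderiv (by norm_num))

theorem IsCbTwo.exists_norm_gradient_le {f : H → ℝ} (hf : IsCbTwo f) :
    ∃ M : ℝ, 0 ≤ M ∧ ∀ x, ‖gradient f x‖ ≤ M := by
  obtain ⟨M, hM⟩ := hf.bounded_fderiv
  refine ⟨M, (norm_nonneg _).trans (hM 0), fun x => ?_⟩
  rw [gradient, LinearIsometryEquiv.norm_map]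
  exact hM x

variable [TopologicalSpace.SeparableSpace H] [MeasurableSpace H] [BorelSpace H]
  (e : HilbertBasis ℕ ℝ H) {lam : ℕ → ℝ} (hpos : ∀ k, 0 < lam k)

/-- The mean of `Df` under the law of the Ornstein–Uhlenbeck process started at `x`. -/
def meanGradient (f : H → ℝ) (t : ℝ) (x : H) : H :=
  ∫ y, gradient f (expCLM e hpos t x + sqrtCLM lam e t y) ∂(gaussianMeasure e lam)

omit [TopologicalSpace.SeparableSpace H] [BorelSpace H] in
theorem ouSemigroup_eq {t : ℝ} (ht : 0 ≤ t) (f : H → ℝ) (x : H) :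
    ouSemigroup e lam t f x
      = ∫ y, f (expCLM e hpos t x + sqrtCLM lam e t y) ∂(gaussianMeasure e lam) := by
  simp only [ouSemigroup, expA_eq_expCLM e hpos ht, sqrtOneSubExpA_eq_sqrtCLM e ht]

omit [TopologicalSpace.SeparableSpace H] [BorelSpace H] in
theorem norm_meanGradient_le [IsProbabilityMeasure (gaussianMeasure e lam)]
    {f : H → ℝ} {M : ℝ} (hM : ∀ x, ‖gradient f x‖ ≤ M) (t : ℝ) (x : H) :
    ‖meanGradient e hpos f t x‖ ≤ M := by
  refine (norm_integral_le_of_norm_le_const (ae_of_all _ fun y => hM _)).trans ?_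
  simp

omit [TopologicalSpace.SeparableSpace H] in
theorem continuous_integral_ornstein {E : Type*} [NormedAddCommGroup E] [NormedSpace ℝ E]
    [SecondCountableTopology E] [IsProbabilityMeasure (gaussianMeasure e lam)] {g : H → E}
    (hg : Continuous g) {M : ℝ} (hM : ∀ x, ‖g x‖ ≤ M) (x : H) :
    Continuous fun t => ∫ y, g (expCLM e hpos t x + sqrtCLM lam e t y)
      ∂(gaussianMeasure e lam) := by
  refine continuous_of_dominated (bound := fun _ => M) (fun t => ?_)
    (fun t => ae_of_all _ fun y => hM _) (integrable_const _) (ae_of_all _ fun y => ?_)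
  · exact Continuous.aestronglyMeasurable (by fun_prop)
  · exact hg.comp ((continuous_expCLM_comp e hpos continuous_const).add
      (continuous_sqrtCLM_comp lam e continuous_const))

omit [TopologicalSpace.SeparableSpace H] [MeasurableSpace H] [BorelSpace H] in
-- Chain rule; the symmetry of e^{tA} moves it from the direction onto the gradient.
theorem hasFDerivAt_comp_ornstein {f : H → ℝ} (hf : Differentiable ℝ f) (t : ℝ) (x y : H) :
    HasFDerivAt (fun x => f (expCLM e hpos t x + sqrtCLM lam e t y))
      (InnerProductSpace.toDual ℝ H (expCLM e hpos t
        (gradient f (expCLM e hpos t x + sqrtCLM lam e t y)))) x := by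
  have h1 := (hf (expCLM e hpos t x + sqrtCLM lam e t y)).hasGradientAt.hasFDerivAt
  have h2 := ((expCLM e hpos t).hasFDerivAt (x := x)).add_const (sqrtCLM lam e t y)
  refine (h1.comp x h2).congr_fderiv ?_
  ext z
  simp only [ContinuousLinearMap.comp_apply, InnerProductSpace.toDual_apply_apply]
  exact (inner_diagCLM_comm _ _ _).symm

variable [IsProbabilityMeasure (gaussianMeasure e lam)] {f : H → ℝ} (hf : IsCbTwo f)
include hf hpos

theorem continuous_meanGradient (x : H) : Continuous fun t => meanGradient e hpos f t x := by
  have := UniformSpace.secondCountable_of_separable H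
  obtain ⟨M, -, hM⟩ := hf.exists_norm_gradient_le
  exact continuous_integral_ornstein e hpos hf.continuous_gradient hM x

theorem integrable_gradient_ornstein (t : ℝ) (x : H) :
    Integrable (fun y => gradient f (expCLM e hpos t x + sqrtCLM lam e t y))
      (gaussianMeasure e lam) := by
  have := UniformSpace.secondCountable_of_separable H
  obtain ⟨M, -, hM⟩ := hf.exists_norm_gradient_le
  have := hf.continuous_gradient
  exact Integrable.of_bound (Continuous.aestronglyMeasurable (by fun_prop)) M
    (ae_of_all _ fun y => hM _)

theorem hasFDerivAt_integral_ornstein (t : ℝ) (x : H) :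
    HasFDerivAt (fun x => ∫ y, f (expCLM e hpos t x + sqrtCLM lam e t y) ∂(gaussianMeasure e lam))
      (InnerProductSpace.toDual ℝ H (expCLM e hpos t (meanGradient e hpos f t x))) x := by
  have := UniformSpace.secondCountable_of_separable H
  obtain ⟨M, -, hM⟩ := hf.exists_norm_gradient_le
  obtain ⟨C, hC⟩ := hf.bounded
  have hfc := hf.contDiff.continuous
  have hgc := hf.continuous_gradient
  have key := hasFDerivAt_integral_of_dominated_of_fderiv_le (μ := gaussianMeasure e lam)
    (F := fun x y => f (expCLM e hpos t x + sqrtCLM lam e t y))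
    (F' := fun x y => InnerProductSpace.toDual ℝ H (expCLM e hpos t
        (gradient f (expCLM e hpos t x + sqrtCLM lam e t y)))) (x₀ := x) (s := Set.univ)
    (bound := fun _ => M) univ_mem
    (Eventually.of_forall fun x => Continuous.aestronglyMeasurable (by fun_prop))
    (Integrable.of_bound (Continuous.aestronglyMeasurable (by fun_prop)) C
      (ae_of_all _ fun y => hC _))
    (Continuous.aestronglyMeasurable (by fun_prop))
    (ae_of_all _ fun y x _ => by
      rw [LinearIsometryEquiv.norm_map]
      exact (norm_expCLM_apply_le e hpos t _).trans (hM _))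
    (integrable_const _)
    (ae_of_all _ fun y x _ => hasFDerivAt_comp_ornstein e hpos hf.differentiable t x y)
  refine key.congr_fderiv ?_
  have h1 := (expCLM e hpos t).integral_comp_comm (integrable_gradient_ornstein e hpos hf t x)
  rw [meanGradient, ← h1]
  exact (InnerProductSpace.toDual ℝ H).toLinearIsometry.integral_comp_comm _

/-- Second differentiation under an integral, now in t, dominated by e^{-t} M where M bounds |Df|.
-/
theorem hasGradientAt_resolventOne (x : H) :
    HasGradientAt (resolventOne e lam f)
      (∫ t in Set.Ioi (0 : ℝ), Real.exp (-t) • expCLM e hpos t (meanGradient e hpos f t x)) x := by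
  have hres : resolventOne e lam f = fun x => ∫ t in Set.Ioi (0 : ℝ), Real.exp (-t) *
      ∫ y, f (expCLM e hpos t x + sqrtCLM lam e t y) ∂(gaussianMeasure e lam) := by
    ext x
    refine setIntegral_congr_fun measurableSet_Ioi fun t ht => ?_
    rw [ouSemigroup_eq e hpos (le_of_lt ht)]
  obtain ⟨M, hM0, hM⟩ := hf.exists_norm_gradient_le
  obtain ⟨C, hC⟩ := hf.bounded
  have hcont (x : H) := continuous_integral_ornstein e hpos hf.contDiff.continuous hC x
  have hgcont : Continuous fun t => expCLM e hpos t (meanGradient e hpos f t x) :=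
    continuous_expCLM_comp e hpos (continuous_meanGradient e hpos hf x)
  have hexp := integrableOn_exp_neg_Ioi 0
  have key := hasFDerivAt_integral_of_dominated_of_fderiv_le
    (μ := volume.restrict (Set.Ioi (0 : ℝ)))
    (F := fun x t => Real.exp (-t) *
      ∫ y, f (expCLM e hpos t x + sqrtCLM lam e t y) ∂(gaussianMeasure e lam))
    (F' := fun x t => Real.exp (-t) • InnerProductSpace.toDual ℝ H
      (expCLM e hpos t (meanGradient e hpos f t x)))
    (x₀ := x) (s := Set.univ) (bound := fun t => Real.exp (-t) * M) univ_mem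
    (Eventually.of_forall fun x => Continuous.aestronglyMeasurable (by
      have := hcont x
      fun_prop))
    (hexp.mul_bdd (c := C) (hcont x).aestronglyMeasurable (ae_of_all _ fun t => by
      refine (norm_integral_le_of_norm_le_const (C := C) (ae_of_all _ fun y => hC _)).trans ?_
      simp))
    (Continuous.aestronglyMeasurable (by fun_prop))
    (ae_of_all _ fun t x _ => by
      rw [norm_smul, LinearIsometryEquiv.norm_map, Real.norm_of_nonneg (Real.exp_pos _).le]
      gcongr
      exact (norm_expCLM_apply_le e hpos t _).trans (norm_meanGradient_le e hpos hM t x))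
    (hexp.mul_const M)
    (ae_of_all _ fun t x _ => (hasFDerivAt_integral_ornstein e hpos hf t x).const_mul _)
  rw [hasGradientAt_iff_hasFDerivAt, hres]
  refine key.congr_fderiv (Eq.trans ?_
    ((InnerProductSpace.toDual ℝ H).toLinearIsometry.integral_comp_comm _))
  congr 1
  ext1 t
  exact ((InnerProductSpace.toDual ℝ H).toLinearIsometry.map_smul _ _).symm

theorem inner_basis_gradient_resolventOne (x : H) (k : ℕ) :
    ⟪e k, gradient (resolventOne e lam f) x⟫ = ∫ t in Set.Ioi (0 : ℝ),
      Real.exp (-(t * lam k)) * (Real.exp (-t) * ⟪e k, meanGradient e hpos f t x⟫) := by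
  obtain ⟨M, hM0, hM⟩ := hf.exists_norm_gradient_le
  have hgcont : Continuous fun t => expCLM e hpos t (meanGradient e hpos f t x) :=
    continuous_expCLM_comp e hpos (continuous_meanGradient e hpos hf x)
  rw [(hasGradientAt_resolventOne e hpos hf x).gradient, ← innerSL_apply_apply ℝ,
    ← ContinuousLinearMap.integral_comp_comm]
  · refine setIntegral_congr_fun measurableSet_Ioi fun t ht => ?_
    simp only [innerSL_apply_apply]
    rw [real_inner_smul_right, inner_basis_expCLM e hpos (le_of_lt ht)]
    ring
  · exact (integrableOn_exp_neg_Ioi 0).smul_bdd M hgcont.aestronglyMeasurable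
      (ae_of_all _ fun t => (norm_expCLM_apply_le e hpos t _).trans
        (norm_meanGradient_le e hpos hM t x))

theorem inner_basis_meanGradient (t : ℝ) (x : H) (k : ℕ) :
    ⟪e k, meanGradient e hpos f t x⟫ = ∫ y, fderiv ℝ f
      (expCLM e hpos t x + sqrtCLM lam e t y) (e k) ∂(gaussianMeasure e lam) := by
  rw [meanGradient, ← innerSL_apply_apply ℝ, ← ContinuousLinearMap.integral_comp_comm _
    (integrable_gradient_ornstein e hpos hf t x)]
  simp only [innerSL_apply_apply]
  congr 1
  ext y
  rw [real_inner_comm, inner_gradient_left]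

/-- Cauchy–Schwarz in t, in the form 2ab ≤ a² + b² with a = λ_k G e^{-tλ_k} and b = e^{-t} v_k(t).
Integration of 2ab reproduces 2λ_k G², while a² integrates to λ_k G²/2. -/
theorem lam_mul_sq_inner_basis_gradient_le (x : H) (k : ℕ) :
    lam k * ⟪e k, gradient (resolventOne e lam f) x⟫ ^ 2 ≤ ∫ t in Set.Ioi (0 : ℝ),
      Real.exp (-(2 * t)) * ⟪e k, meanGradient e hpos f t x⟫ ^ 2 := by
  obtain ⟨M, hM0, hM⟩ := hf.exists_norm_gradient_le
  have hvc := continuous_meanGradient e hpos hf x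
  have hv (t : ℝ) : |⟪e k, meanGradient e hpos f t x⟫| ≤ M := by
    refine (abs_real_inner_le_norm _ _).trans ?_
    rw [e.orthonormal.1 k, one_mul]
    exact norm_meanGradient_le e hpos hM t x
  set G := ⟪e k, gradient (resolventOne e lam f) x⟫ with hG
  have hl := hpos k
  have h2 : IntegrableOn (fun t => lam k ^ 2 * G ^ 2 * Real.exp (-(2 * lam k) * t))
      (Set.Ioi 0) := (integrableOn_exp_mul_Ioi (by linarith) 0).const_mul _
  have h3 : IntegrableOn (fun t => Real.exp (-(2 * t)) * ⟪e k, meanGradient e hpos f t x⟫ ^ 2)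
      (Set.Ioi 0) := by
    have h0 : IntegrableOn (fun t : ℝ => Real.exp (-(2 * t))) (Set.Ioi 0) :=
      (integrableOn_exp_mul_Ioi (a := -2) (by norm_num) 0).congr_fun (fun t _ => by ring_nf)
        measurableSet_Ioi
    refine h0.mul_bdd (c := M ^ 2) (Continuous.aestronglyMeasurable (by fun_prop))
      (ae_of_all _ fun t => ?_)
    rw [Real.norm_of_nonneg (sq_nonneg _)]
    exact sq_le_sq' (abs_le.1 (hv t)).1 (abs_le.1 (hv t)).2
  have h4 : ∫ t in Set.Ioi (0 : ℝ), lam k ^ 2 * G ^ 2 * Real.exp (-(2 * lam k) * t)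
      = lam k * G ^ 2 / 2 := by
    rw [integral_const_mul, integral_exp_mul_Ioi (by linarith)]
    simp
    field_simp
  have h1 : IntegrableOn (fun t => 2 * (lam k * G) * (Real.exp (-(t * lam k)) *
      (Real.exp (-t) * ⟪e k, meanGradient e hpos f t x⟫))) (Set.Ioi 0) := by
    refine Integrable.mono' (h2.add h3) (Continuous.aestronglyMeasurable (by fun_prop))
      (ae_of_all _ fun t => ?_)
    have e1 : Real.exp (-(2 * lam k) * t) = Real.exp (-(t * lam k)) ^ 2 := by
      rw [← Real.exp_nat_mul]; ring_nf
    have e2 : Real.exp (-(2 * t)) = Real.exp (-t) ^ 2 := by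
      rw [← Real.exp_nat_mul]; ring_nf
    simp only [Pi.add_apply, Real.norm_eq_abs]
    rw [e1, e2, abs_le]
    constructor <;>
    nlinarith [sq_nonneg (lam k * G * Real.exp (-(t * lam k)) -
      Real.exp (-t) * ⟪e k, meanGradient e hpos f t x⟫),
      sq_nonneg (lam k * G * Real.exp (-(t * lam k)) +
      Real.exp (-t) * ⟪e k, meanGradient e hpos f t x⟫)]
  have hle := integral_mono h1 (h2.add h3) fun t => by
    have e1 : Real.exp (-(2 * lam k) * t) = Real.exp (-(t * lam k)) ^ 2 := by
      rw [← Real.exp_nat_mul]; ring_nf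
    have e2 : Real.exp (-(2 * t)) = Real.exp (-t) ^ 2 := by
      rw [← Real.exp_nat_mul]; ring_nf
    simp only [Pi.add_apply]
    rw [e1, e2]
    nlinarith [sq_nonneg (lam k * G * Real.exp (-(t * lam k)) -
      Real.exp (-t) * ⟪e k, meanGradient e hpos f t x⟫)]
  simp only [Pi.add_apply] at hle
  rw [integral_const_mul, ← inner_basis_gradient_resolventOne e hpos hf x k, ← hG,
    integral_add h2 h3, h4] at hle
  -- What remains is (3/2) λ_k G² ≤ ∫ e^{-2t} v_k²; nonnegativity allows the excess factor to be
  -- dropped.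
  have : 0 ≤ lam k * G ^ 2 := by positivity
  linarith [show 2 * (lam k * G) * G = 2 * (lam k * G ^ 2) by ring]

/-- Summing the coordinate bounds under the integral, Bessel's inequality bounds every finite sum by
∫ e^{-2t} M² dt. -/
theorem gradient_resolventOne_mem_domSqrtNegA (x : H) :
    gradient (resolventOne e lam f) x ∈ domSqrtNegA e lam := by
  obtain ⟨M, hM0, hM⟩ := hf.exists_norm_gradient_le
  have hvc := continuous_meanGradient e hpos hf x
  have h0 : IntegrableOn (fun t : ℝ => Real.exp (-(2 * t))) (Set.Ioi 0) :=
    (integrableOn_exp_mul_Ioi (a := -2) (by norm_num) 0).congr_fun (fun t _ => by ring_nf)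
      measurableSet_Ioi
  have hv (t : ℝ) (s : Finset ℕ) : ∑ k ∈ s, ⟪e k, meanGradient e hpos f t x⟫ ^ 2 ≤ M ^ 2 := by
    refine (sum_le_hasSum s (fun k _ => sq_nonneg _) (hasSum_inner_basis_sq e _)).trans ?_
    have := norm_meanGradient_le e hpos hM t x
    gcongr
  have hbd (s : Finset ℕ) : IntegrableOn (fun t => Real.exp (-(2 * t)) *
      ∑ k ∈ s, ⟪e k, meanGradient e hpos f t x⟫ ^ 2) (Set.Ioi 0) := by
    refine h0.mul_bdd (c := M ^ 2) (Continuous.aestronglyMeasurable (by fun_prop))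
      (ae_of_all _ fun t => ?_)
    rw [Real.norm_of_nonneg (Finset.sum_nonneg fun k _ => sq_nonneg _)]
    exact hv t s
  refine summable_of_sum_le (fun k => sq_nonneg _)
    (c := ∫ t in Set.Ioi (0 : ℝ), Real.exp (-(2 * t)) * M ^ 2) fun s => ?_
  calc ∑ k ∈ s, (√(- -lam k) * ⟪e k, gradient (resolventOne e lam f) x⟫) ^ 2
      ≤ ∑ k ∈ s, ∫ t in Set.Ioi (0 : ℝ),
        Real.exp (-(2 * t)) * ⟪e k, meanGradient e hpos f t x⟫ ^ 2 := by
        refine Finset.sum_le_sum fun k _ => ?_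
        rw [mul_pow, neg_neg, Real.sq_sqrt (hpos k).le]
        exact lam_mul_sq_inner_basis_gradient_le e hpos hf x k
    _ = ∫ t in Set.Ioi (0 : ℝ), Real.exp (-(2 * t)) *
        ∑ k ∈ s, ⟪e k, meanGradient e hpos f t x⟫ ^ 2 := by
        rw [← integral_finsetSum]
        · simp_rw [Finset.mul_sum]
        · intro k _
          simpa using! hbd {k}
    _ ≤ _ := by
        refine integral_mono (hbd s) (h0.mul_const _) fun t => ?_
        have := hv t s
        simp only
        gcongr

end Gradient

/-! ### Closure properties of C²_b and trigonometric examples -/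

section CbTwo

variable {H : Type*} [NormedAddCommGroup H] [InnerProductSpace ℝ H]

/-- Phrasing the bounds through iterated derivatives makes the Leibniz estimate available for
products. -/
theorem isCbTwo_iff {f : H → ℝ} : IsCbTwo f ↔
    ContDiff ℝ 2 f ∧ ∀ i ≤ 2, ∃ C : ℝ, ∀ x, ‖iteratedFDeriv ℝ i f x‖ ≤ C := by
  have h2 (x : H) : ‖iteratedFDeriv ℝ 2 f x‖ = ‖fderiv ℝ (fderiv ℝ f) x‖ := by
    rw [← norm_iteratedFDeriv_fderiv, ← norm_iteratedFDeriv_one]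
  constructor
  · rintro ⟨h, h0, h1, h2'⟩
    refine ⟨h, fun i hi => ?_⟩
    interval_cases i
    · simpa [norm_iteratedFDeriv_zero] using h0
    · simpa [norm_iteratedFDeriv_one] using h1
    · simpa [h2] using h2'
  · rintro ⟨h, hb⟩
    exact ⟨h, by simpa [norm_iteratedFDeriv_zero] using hb 0 (by norm_num),
      by simpa [norm_iteratedFDeriv_one] using hb 1 (by norm_num), by simpa [h2] using hb 2 le_rfl⟩

theorem IsCbTwo.add {f g : H → ℝ} (hf : IsCbTwo f) (hg : IsCbTwo g) :
    IsCbTwo fun x => f x + g x := by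
  rw [isCbTwo_iff] at *
  refine ⟨hf.1.add hg.1, fun i hi => ?_⟩
  obtain ⟨C, hC⟩ := hf.2 i hi
  obtain ⟨D, hD⟩ := hg.2 i hi
  refine ⟨C + D, fun x => ?_⟩
  have hi' : (i : WithTop ℕ∞) ≤ 2 := by exact_mod_cast hi
  rw [fun_iteratedFDeriv_add (hf.1.of_le hi') (hg.1.of_le hi')]
  exact (norm_add_le _ _).trans (add_le_add (hC x) (hD x))

theorem IsCbTwo.mul {f g : H → ℝ} (hf : IsCbTwo f) (hg : IsCbTwo g) :
    IsCbTwo fun x => f x * g x := by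
  rw [isCbTwo_iff] at *
  refine ⟨hf.1.mul hg.1, fun i hi => ?_⟩
  choose! C hC using hf.2
  choose! D hD using hg.2
  refine ⟨∑ j ∈ Finset.range (i + 1), (i.choose j : ℝ) * C j * D (i - j), fun x => ?_⟩
  have hi' : (i : WithTop ℕ∞) ≤ 2 := by exact_mod_cast hi
  refine (norm_iteratedFDeriv_mul_le hf.1 hg.1 x hi').trans (Finset.sum_le_sum fun j hj => ?_)
  rw [Finset.mem_range] at hj
  have h1 := hC j (by omega) x
  have h2 := hD (i - j) (by omega) x
  have := (norm_nonneg _).trans h1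
  gcongr

theorem isCbTwo_const (c : ℝ) : IsCbTwo fun _ : H => c := by
  have h : fderiv ℝ (fun _ : H => c) = fun _ => 0 := fderiv_fun_const c
  refine ⟨contDiff_const, ⟨|c|, fun _ => le_rfl⟩, ⟨0, fun x => ?_⟩, ⟨0, fun x => ?_⟩⟩
  · rw [h, norm_zero]
  · rw [h, fderiv_fun_const, Pi.zero_apply]
    exact (norm_zero (E := H →L[ℝ] H →L[ℝ] ℝ)).le

theorem IsCbTwo.sub {f g : H → ℝ} (hf : IsCbTwo f) (hg : IsCbTwo g) :
    IsCbTwo fun x => f x - g x := by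
  simpa [sub_eq_add_neg] using hf.add ((isCbTwo_const (-1)).mul hg)

theorem IsCbTwo.finset_sum {ι : Type*} (s : Finset ι) {f : ι → H → ℝ} (hf : ∀ i ∈ s, IsCbTwo (f i)) :
    IsCbTwo fun x => ∑ i ∈ s, f i x := by
  classical
  induction s using Finset.induction_on with
  | empty => simpa using isCbTwo_const 0
  | insert a s ha ih =>
    simp only [Finset.sum_insert ha]
    exact (hf a (Finset.mem_insert_self _ _)).add
      (ih fun i hi => hf i (Finset.mem_insert_of_mem hi))

theorem IsCbTwo.finset_prod {ι : Type*} (s : Finset ι) {f : ι → H → ℝ}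
    (hf : ∀ i ∈ s, IsCbTwo (f i)) : IsCbTwo fun x => ∏ i ∈ s, f i x := by
  classical
  induction s using Finset.induction_on with
  | empty => simpa using isCbTwo_const 1
  | insert a s ha ih =>
    simp only [Finset.prod_insert ha]
    exact (hf a (Finset.mem_insert_self _ _)).mul
      (ih fun i hi => hf i (Finset.mem_insert_of_mem hi))

theorem isCbTwo_sin_affine (L : H →L[ℝ] ℝ) (b : ℝ) : IsCbTwo fun x => Real.sin (L x + b) := by
  have hL (x : H) : HasFDerivAt (fun x => L x + b) L x := L.hasFDerivAt.add_const b
  have h1 : fderiv ℝ (fun x => Real.sin (L x + b)) = fun x => Real.cos (L x + b) • L := by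
    ext1 x
    exact (hL x).sin.fderiv
  have h2 (x : H) : fderiv ℝ (fun x => Real.cos (L x + b) • L) x
      = (-Real.sin (L x + b) • L).smulRight L :=
    ((hL x).cos.smul_const L).fderiv
  refine ⟨by fun_prop, ⟨1, fun x => Real.abs_sin_le_one _⟩, ⟨‖L‖, fun x => ?_⟩,
    ⟨‖L‖ * ‖L‖, fun x => ?_⟩⟩
  · rw [h1, norm_smul]
    exact mul_le_of_le_one_left (norm_nonneg _) (Real.abs_cos_le_one _)
  · rw [h1, h2, ContinuousLinearMap.norm_smulRight_apply, norm_smul, norm_neg]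
    gcongr
    exact mul_le_of_le_one_left (norm_nonneg _) (Real.abs_sin_le_one _)

theorem isCbTwo_sin_mul_inner (c : ℝ) (v : H) : IsCbTwo fun x => Real.sin (c * ⟪v, x⟫) := by
  simpa using isCbTwo_sin_affine (c • innerSL ℝ v) 0

theorem isCbTwo_cos_mul_inner (c : ℝ) (v : H) : IsCbTwo fun x => Real.cos (c * ⟪v, x⟫) := by
  simpa [Real.sin_add_pi_div_two] using isCbTwo_sin_affine (c • innerSL ℝ v) (Real.pi / 2)

end CbTwo

/-! ### Gaussian expectations of products of coordinate functions -/

section Expectation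

theorem integral_cos_gaussianReal (v : ℝ≥0) (c : ℝ) :
    ∫ u, Real.cos (c * u) ∂(gaussianReal 0 v) = Real.exp (-(v * c ^ 2 / 2)) := by
  have h := charFun_gaussianReal (μ := 0) (v := v) c
  rw [charFun_apply_real] at h
  have h1 : Integrable (fun u : ℝ => Complex.exp (c * u * Complex.I)) (gaussianReal 0 v) := by
    refine Integrable.of_bound (Continuous.aestronglyMeasurable (by fun_prop)) 1
      (ae_of_all _ fun u => ?_)
    rw [← Complex.ofReal_mul, Complex.norm_exp_ofReal_mul_I]
  have h2 := congrArg Complex.re h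
  rw [← RCLike.re_to_complex, ← integral_re h1] at h2
  convert h2 using 1
  · congr 1
    ext u
    rw [← Complex.ofReal_mul, RCLike.re_to_complex, Complex.exp_ofReal_mul_I_re]
  · have : ((c : ℂ) * ((0 : ℝ) : ℂ) * Complex.I - v * c ^ 2 / 2)
        = ((-(v * c ^ 2 / 2) : ℝ) : ℂ) := by
      push_cast; ring
    rw [this, Complex.exp_ofReal_re]

variable {H : Type*} [NormedAddCommGroup H] [InnerProductSpace ℝ H] [CompleteSpace H]
  [MeasurableSpace H] [BorelSpace H] (e : HilbertBasis ℕ ℝ H) {lam : ℕ → ℝ}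

/-- Almost surely the series is square summable, so its coordinates are the independent ξ_k and the
integral factorizes. -/
theorem integral_prod_gaussianMeasure (hsum : Summable fun k => 1 / lam k) (s : Finset ℕ)
    {φ : ℕ → ℝ → ℝ} (hφ : ∀ k, Continuous (φ k)) :
    ∫ y, ∏ k ∈ s, φ k ⟪e k, y⟫ ∂(gaussianMeasure e lam)
      = ∏ k ∈ s, ∫ u, φ k u ∂(gaussianReal 0 (Real.toNNReal (1 / (2 * lam k)))) := by
  have hc : Continuous fun y : H => ∏ k ∈ s, φ k ⟪e k, y⟫ :=
    continuous_finsetProd _ fun k _ => (hφ k).comp (by fun_prop)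
  rw [gaussianMeasure, integral_map (aemeasurable_series e hsum) hc.measurable.aestronglyMeasurable]
  have h1 : ∫ ξ : ℕ → ℝ, ∏ k ∈ s, φ k ⟪e k, ∑' i, ξ i • e i⟫
      ∂(Measure.infinitePi fun k => gaussianReal 0 (Real.toNNReal (1 / (2 * lam k))))
      = ∫ ξ : ℕ → ℝ, (fun z : s → ℝ => ∏ k : s, φ k (z k)) (s.restrict ξ)
      ∂(Measure.infinitePi fun k => gaussianReal 0 (Real.toNNReal (1 / (2 * lam k)))) := by
    refine integral_congr_ae ?_
    filter_upwards [ae_summable_sq hsum] with ξ hξ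
    simp only [inner_basis_tsum e hξ, Finset.restrict]
    rw [Finset.prod_coe_sort s fun k => φ k (ξ k)]
  have hc2 : Continuous fun z : s → ℝ => ∏ k : s, φ k (z k) :=
    continuous_finsetProd _ fun k _ => (hφ k).comp (by fun_prop)
  refine h1.trans ((integral_restrict_infinitePi (X := fun _ => ℝ) (s := s)
    (f := fun z => ∏ k : s, φ k (z k)) _ hc2.measurable.aestronglyMeasurable).trans ?_)
  rw [integral_fintype_prod_eq_prod (fun (k : s) u => φ k u)]
  exact Finset.prod_coe_sort s fun k =>
    ∫ u, φ k u ∂(gaussianReal 0 (Real.toNNReal (1 / (2 * lam k))))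

end Expectation

/-! ### Mean of the cutoffs and choice of separated time scales -/

section Level

/-- The mean of `cutoff e lam m` under the law at time `t` of the Ornstein–Uhlenbeck process
started at `0`. -/
def level (lam : ℕ → ℝ) (m : ℕ) (t : ℝ) : ℝ :=
  ∏ i ∈ Finset.range m, (1 + Real.exp (-((1 - Real.exp (-(2 * (t * lam (2 * i))))) / 4))) / 2

variable {lam : ℕ → ℝ}

theorem level_nonneg (m : ℕ) (t : ℝ) : 0 ≤ level lam m t :=
  Finset.prod_nonneg fun i _ => by positivity

theorem continuous_level (m : ℕ) : Continuous (level lam m) := by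
  unfold level
  fun_prop

theorem level_zero_right (m : ℕ) : level lam m 0 = 1 := by
  simp [level]

theorem level_anti_right (hpos : ∀ k, 0 < lam k) (m : ℕ) : Antitone (level lam m) := by
  intro s t hst
  refine Finset.prod_le_prod (fun i _ => by positivity) fun i _ => ?_
  have := hpos (2 * i)
  gcongr

theorem one_add_exp_div_two_le_one {s : ℝ} (hs : 0 ≤ s) :
    (1 + Real.exp (-((1 - Real.exp (-(2 * s))) / 4))) / 2 ≤ 1 := by
  have h1 : Real.exp (-(2 * s)) ≤ 1 := Real.exp_le_one_iff.2 (by linarith)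
  have h2 : Real.exp (-((1 - Real.exp (-(2 * s))) / 4)) ≤ 1 := Real.exp_le_one_iff.2 (by linarith)
  linarith

theorem level_anti_left (hpos : ∀ k, 0 < lam k) {t : ℝ} (ht : 0 ≤ t) :
    Antitone fun m => level lam m t := by
  refine antitone_nat_of_succ_le fun m => ?_
  rw [level, Finset.prod_range_succ]
  exact mul_le_of_le_one_right (level_nonneg m t)
    (one_add_exp_div_two_le_one (mul_nonneg ht (hpos _).le))

theorem level_le_pow (hmono : StrictMono lam) {t : ℝ} (ht : 0 ≤ t)
    (m : ℕ) :
    level lam m t ≤ ((1 + Real.exp (-((1 - Real.exp (-(2 * (t * lam 0)))) / 4))) / 2) ^ m := by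
  refine (Finset.prod_le_prod (fun i _ => by positivity) fun i _ => ?_).trans_eq
    (by rw [Finset.prod_const, Finset.card_range])
  have := hmono.monotone (Nat.zero_le (2 * i))
  gcongr

/-- Since λ_{2i} ≥ λ_0, all factors are at most one number that is less than 1 for t > 0, so the
product decays geometrically. -/
theorem tendsto_level_atTop (hpos : ∀ k, 0 < lam k) (hmono : StrictMono lam) {t : ℝ}
    (ht : 0 < t) : Tendsto (fun m => level lam m t) atTop (𝓝 0) := by
  refine squeeze_zero (fun m => level_nonneg m t) (level_le_pow hmono ht.le)
    (tendsto_pow_atTop_nhds_zero_of_lt_one (by positivity) ?_)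
  have h0 := mul_pos ht (hpos 0)
  have h1 : Real.exp (-(2 * (t * lam 0))) < 1 := Real.exp_lt_one_iff.2 (by linarith)
  have h2 : Real.exp (-((1 - Real.exp (-(2 * (t * lam 0)))) / 4)) < 1 :=
    Real.exp_lt_one_iff.2 (by linarith)
  linarith

/-- The order of choice matters: with m fixed, k is taken odd and so large that time 2/λ_k is too
short for the m-th cutoff to decay; then m' is taken so large that its cutoff has decayed by time
1/λ_k. -/
theorem exists_odd_index (hpos : ∀ k, 0 < lam k) (hmono : StrictMono lam)
    (htop : Tendsto lam atTop atTop) (m : ℕ) :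
    ∃ k m', m ≤ k ∧ k < m' ∧ (∀ i, k ≠ 2 * i) ∧ 2 ≤ lam k ∧
      3 / 4 ≤ level lam m (2 / lam k) ∧ level lam m' (1 / lam k) ≤ 1 / 4 := by
  have h1 : Tendsto (fun k => level lam m (2 / lam k)) atTop (𝓝 1) := by
    rw [← level_zero_right (lam := lam) m]
    exact ((continuous_level m).tendsto 0).comp (htop.const_div_atTop 2)
  obtain ⟨N, hN⟩ := eventually_atTop.1 ((h1.eventually (lt_mem_nhds (by norm_num :
    (3 / 4 : ℝ) < 1))).and ((htop.eventually_ge_atTop 2).and (eventually_ge_atTop m)))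
  obtain ⟨h2, h3, h4⟩ := hN (2 * N + 1) (by omega)
  have h5 := tendsto_level_atTop hpos hmono (one_div_pos.2 (hpos (2 * N + 1)))
  obtain ⟨m', hm', hlt⟩ := ((h5.eventually (gt_mem_nhds (by norm_num : (0 : ℝ) < 1 / 4))).and
    (eventually_gt_atTop (2 * N + 1))).exists
  exact ⟨2 * N + 1, m', h4, hlt, fun i => by omega, h3, h2.le, hm'.le⟩

/-- Iteration from 0; the interlacing m_j ≤ κ_j < m_{j+1} yields both monotonicity claims. -/
theorem exists_scales (hpos : ∀ k, 0 < lam k) (hmono : StrictMono lam)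
    (htop : Tendsto lam atTop atTop) :
    ∃ m κ : ℕ → ℕ, m 0 = 0 ∧ Monotone m ∧ StrictMono κ ∧ ∀ j, (∀ i, κ j ≠ 2 * i) ∧
      2 ≤ lam (κ j) ∧ 3 / 4 ≤ level lam (m j) (2 / lam (κ j)) ∧
      level lam (m (j + 1)) (1 / lam (κ j)) ≤ 1 / 4 := by
  choose K M h1 h2 h3 using exists_odd_index hpos hmono htop
  refine ⟨fun j => M^[j] 0, fun j => K (M^[j] 0), rfl, ?_, ?_, fun j => ?_⟩
  · refine monotone_nat_of_le_succ fun j => ?_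
    rw [Function.iterate_succ_apply']
    exact ((h1 _).trans_lt (h2 _)).le
  · refine strictMono_nat_of_lt_succ fun j => ?_
    rw [Function.iterate_succ_apply']
    exact (h2 _).trans_le (h1 _)
  · simp only [Function.iterate_succ_apply']
    exact h3 _

end Level

/-! ### The test function: its sup bound and its partial derivatives -/

section TestFunction

variable {H : Type*} [NormedAddCommGroup H] [InnerProductSpace ℝ H] (e : HilbertBasis ℕ ℝ H)
  (lam : ℕ → ℝ)

/-- A smooth cutoff in the first `m` even coordinates. -/
def cutoff (m : ℕ) (x : H) : ℝ :=
  ∏ i ∈ Finset.range m, (1 + Real.cos (√(lam (2 * i)) * ⟪e (2 * i), x⟫)) / 2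

theorem cutoff_nonneg (m : ℕ) (x : H) : 0 ≤ cutoff e lam m x :=
  Finset.prod_nonneg fun i _ => by
    linarith [Real.neg_one_le_cos (√(lam (2 * i)) * ⟪e (2 * i), x⟫)]

theorem cutoff_anti (x : H) : Antitone fun m => cutoff e lam m x := by
  refine antitone_nat_of_succ_le fun m => ?_
  rw [cutoff, Finset.prod_range_succ]
  refine mul_le_of_le_one_right (cutoff_nonneg e lam m x) ?_
  linarith [Real.cos_le_one (√(lam (2 * m)) * ⟪e (2 * m), x⟫)]

theorem isCbTwo_cutoff (m : ℕ) : IsCbTwo (cutoff e lam m) := by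
  refine IsCbTwo.finset_prod _ fun i _ => ?_
  simpa [div_eq_mul_inv] using ((isCbTwo_const 1).add
    (isCbTwo_cos_mul_inner (√(lam (2 * i))) (e (2 * i)))).mul (isCbTwo_const 2⁻¹)

theorem cutoff_add_smul_of_odd {k : ℕ} (hk : ∀ i, k ≠ 2 * i) (m : ℕ) (x : H) (s : ℝ) :
    cutoff e lam m (x + s • e k) = cutoff e lam m x := by
  refine Finset.prod_congr rfl fun i _ => ?_
  rw [inner_add_right, real_inner_smul_right, e.orthonormal.2 (hk i).symm, mul_zero, add_zero]

/-- Oscillations in the coordinates `κ j`, localized at separate time scales by differences of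
cutoffs. -/
def testFun (m κ : ℕ → ℕ) (n : ℕ) (x : H) : ℝ :=
  ∑ j ∈ Finset.range n, (cutoff e lam (m j) x - cutoff e lam (m (j + 1)) x) *
    Real.sin (√(lam (κ j)) * ⟪e (κ j), x⟫)

theorem isCbTwo_testFun (m κ : ℕ → ℕ) (n : ℕ) : IsCbTwo (testFun e lam m κ n) :=
  IsCbTwo.finset_sum _ fun _ _ => ((isCbTwo_cutoff e lam _).sub (isCbTwo_cutoff e lam _)).mul
    (isCbTwo_sin_mul_inner _ _)

/-- The weights are nonnegative and telescope to 1 - `cutoff e lam (m n) x`, the empty product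
`cutoff e lam 0` being 1. -/
theorem abs_testFun_le_one {m : ℕ → ℕ} (hm0 : m 0 = 0) (hm : Monotone m) (κ : ℕ → ℕ) (n : ℕ)
    (x : H) : |testFun e lam m κ n x| ≤ 1 := by
  refine (Finset.abs_sum_le_sum_abs _ _).trans ?_
  calc _ ≤ ∑ j ∈ Finset.range n, (cutoff e lam (m j) x - cutoff e lam (m (j + 1)) x) := by
        refine Finset.sum_le_sum fun j _ => ?_
        have := cutoff_anti e lam x (hm j.le_succ)
        rw [abs_mul, abs_of_nonneg (sub_nonneg.2 this)]
        exact mul_le_of_le_one_right (sub_nonneg.2 this) (Real.abs_sin_le_one _)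
    _ = 1 - cutoff e lam (m n) x := by
        rw [Finset.sum_range_sub' fun j => cutoff e lam (m j) x, hm0]
        simp [cutoff]
    _ ≤ 1 := by linarith [cutoff_nonneg e lam (m n) x]

/-- Along an odd basis vector the cutoffs are constant, and by injectivity of κ so are all sines
except the j-th. -/
theorem fderiv_testFun_apply {m κ : ℕ → ℕ} (hκ : StrictMono κ) (hodd : ∀ j i, κ j ≠ 2 * i)
    {n j : ℕ} (hj : j < n) (x : H) :
    fderiv ℝ (testFun e lam m κ n) x (e (κ j)) =
      √(lam (κ j)) * ((cutoff e lam (m j) x - cutoff e lam (m (j + 1)) x) *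
        Real.cos (√(lam (κ j)) * ⟪e (κ j), x⟫)) := by
  have hd : DifferentiableAt ℝ (testFun e lam m κ n) x :=
    (isCbTwo_testFun e lam m κ n).contDiff.differentiable (by norm_num) x
  rw [← hd.lineDeriv_eq_fderiv]
  refine HasLineDerivAt.lineDeriv ?_
  rw [HasLineDerivAt]
  have h1 : ∀ i ∈ Finset.range n, HasDerivAt (fun s : ℝ =>
      (cutoff e lam (m i) (x + s • e (κ j)) - cutoff e lam (m (i + 1)) (x + s • e (κ j))) *
        Real.sin (√(lam (κ i)) * ⟪e (κ i), x + s • e (κ j)⟫))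
      (if i = j then √(lam (κ j)) * ((cutoff e lam (m j) x - cutoff e lam (m (j + 1)) x) *
        Real.cos (√(lam (κ j)) * ⟪e (κ j), x⟫)) else 0) 0 := by
    intro i _
    simp only [cutoff_add_smul_of_odd e lam (hodd j)]
    split_ifs with hij
    · subst hij
      simp only [inner_add_right, real_inner_smul_right, real_inner_self_eq_norm_sq,
        e.orthonormal.1, one_pow, mul_one]
      have h2 : HasDerivAt (fun s : ℝ => √(lam (κ i)) * (⟪e (κ i), x⟫ + s)) (√(lam (κ i))) 0 := by
        simpa using ((hasDerivAt_id (0 : ℝ)).const_add ⟪e (κ i), x⟫).const_mul √(lam (κ i))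
      refine (h2.sin.const_mul _).congr_deriv ?_
      rw [add_zero]
      ring
    · simp only [inner_add_right, real_inner_smul_right,
        e.orthonormal.2 (hκ.injective.ne hij), mul_zero, add_zero]
      exact hasDerivAt_const _ _
  refine (HasDerivAt.fun_sum h1).congr_deriv ?_
  rw [Finset.sum_ite_eq' , if_pos (Finset.mem_range.2 hj)]

end TestFunction

/-! ### Means under the process started at the origin -/

section Mean

variable {H : Type*} [NormedAddCommGroup H] [InnerProductSpace ℝ H] [CompleteSpace H]
  [MeasurableSpace H] [BorelSpace H] (e : HilbertBasis ℕ ℝ H) {lam : ℕ → ℝ}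

/-- The k-th coordinate at time t has variance (1 - e^{-2tλ_k})/(2λ_k); the frequency √λ_k cancels
λ_k, leaving a bound e^{-1/4} from below uniform in k and t. -/
theorem integral_cos_ornstein (hpos : ∀ k, 0 < lam k) {t : ℝ} (ht : 0 ≤ t) (k : ℕ) :
    ∫ u, Real.cos (√(lam k) * √(1 - Real.exp (-(2 * (t * lam k)))) * u)
      ∂(gaussianReal 0 (Real.toNNReal (1 / (2 * lam k))))
      = Real.exp (-((1 - Real.exp (-(2 * (t * lam k)))) / 4)) := by
  have hl := hpos k
  have h1 : Real.exp (-(2 * (t * lam k))) ≤ 1 :=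
    Real.exp_le_one_iff.2 (by have := mul_nonneg ht hl.le; linarith)
  rw [integral_cos_gaussianReal, Real.coe_toNNReal _ (by positivity), mul_pow,
    Real.sq_sqrt hl.le, Real.sq_sqrt (by linarith)]
  congr 2
  field_simp
  ring

theorem integral_cutoff_mul_cos (hpos : ∀ k, 0 < lam k) (hsum : Summable fun k => 1 / lam k)
    {t : ℝ} (ht : 0 ≤ t) {k : ℕ} (hk : ∀ i, k ≠ 2 * i) (m : ℕ) :
    ∫ y, cutoff e lam m (sqrtCLM lam e t y) *
        Real.cos (√(lam k) * ⟪e k, sqrtCLM lam e t y⟫) ∂(gaussianMeasure e lam)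
      = level lam m t * Real.exp (-((1 - Real.exp (-(2 * (t * lam k)))) / 4)) := by
  set a : ℕ → ℝ := fun i => √(lam i) * √(1 - Real.exp (-(2 * (t * lam i)))) with ha
  -- One family of factors covers both the oscillation at k and the cutoffs at even indices; k being
  -- odd keeps the two cases apart.
  set φ : ℕ → ℝ → ℝ := fun i u => if i = k then Real.cos (a i * u) else
    (1 + Real.cos (a i * u)) / 2 with hφ
  have hφc (i : ℕ) : Continuous (φ i) := by
    by_cases h : i = k
    · simp only [hφ, h, if_true]
      fun_prop
    · simp only [hφ, h, if_false]
      fun_prop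
  have hnot : k ∉ (Finset.range m).image (2 * ·) := by
    simp only [Finset.mem_image, not_exists, not_and]
    exact fun i _ => (hk i).symm
  have hinj : Set.InjOn (2 * ·) (Finset.range m : Set ℕ) := fun i _ j _ h => by
    simpa using h
  have key := integral_prod_gaussianMeasure e hsum
    (insert k ((Finset.range m).image (2 * ·))) hφc
  simp only [Finset.prod_insert hnot, Finset.prod_image hinj] at key
  have hφk : φ k = fun u => Real.cos (a k * u) := by simp [hφ]
  have hφi (i : ℕ) : φ (2 * i) = fun u => (1 + Real.cos (a (2 * i) * u)) / 2 := by
    simp [hφ, (hk i).symm]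
  simp only [hφk, hφi] at key
  have hint (i : ℕ) : Integrable (fun u => Real.cos (a i * u))
      (gaussianReal 0 (Real.toNNReal (1 / (2 * lam i)))) :=
    Integrable.of_bound (Continuous.aestronglyMeasurable (by fun_prop)) 1
      (ae_of_all _ fun u => Real.abs_cos_le_one _)
  have hval (i : ℕ) : ∫ u, (1 + Real.cos (a i * u)) / 2
      ∂(gaussianReal 0 (Real.toNNReal (1 / (2 * lam i))))
      = (1 + Real.exp (-((1 - Real.exp (-(2 * (t * lam i)))) / 4))) / 2 := by
    rw [integral_div, integral_add (integrable_const _) (hint i), ha,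
      integral_cos_ornstein hpos ht]
    simp
  simp only [hval] at key
  rw [ha, integral_cos_ornstein hpos ht] at key
  rw [level, mul_comm, ← key]
  congr 1
  ext y
  rw [mul_comm]
  simp only [cutoff, inner_basis_sqrtCLM e ht, mul_assoc]

end Mean

/-! ### Lower bound at the origin -/

section LowerBound

/-- The integrand is nonnegative, so only [1/l, 2/l] is kept. There e^{-tl} ≥ e^{-2}, e^{-t} ≥
e^{-1} because l ≥ 2, the levels differ by at least 3/4 - 1/4 by monotonicity in t, and the last
factor is at least e^{-1/4}. The interval length 1/l cancels the prefactor. -/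
theorem mul_level_sub_le_integral {lam : ℕ → ℝ} (hpos : ∀ k, 0 < lam k) {m m' : ℕ} (hm : m ≤ m')
    {l : ℝ} (hl : 2 ≤ l) (h1 : 3 / 4 ≤ level lam m (2 / l)) (h2 : level lam m' (1 / l) ≤ 1 / 4) :
    Real.exp (-2) * (Real.exp (-1) * (1 / 2 * Real.exp (-(1 / 4)))) ≤
      l * ∫ t in Set.Ioi (0 : ℝ), Real.exp (-(t * l)) * (Real.exp (-t) *
        ((level lam m t - level lam m' t) *
          Real.exp (-((1 - Real.exp (-(2 * (t * l)))) / 4)))) := by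
  have hl0 : 0 < l := by linarith
  have hanti {t : ℝ} (ht : 0 ≤ t) : level lam m' t ≤ level lam m t := level_anti_left hpos ht hm
  have hle1 {t : ℝ} (ht : 0 ≤ t) : level lam m t ≤ 1 :=
    (level_anti_right hpos m ht).trans_eq (level_zero_right m)
  have hexp1 {t : ℝ} (ht : 0 ≤ t) : Real.exp (-((1 - Real.exp (-(2 * (t * l)))) / 4)) ≤ 1 := by
    have := Real.exp_le_one_iff.2 (show -(2 * (t * l)) ≤ 0 by
      have := mul_nonneg ht hl0.le
      linarith)
    exact Real.exp_le_one_iff.2 (by linarith)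
  set h : ℝ → ℝ := fun t => Real.exp (-(t * l)) * (Real.exp (-t) *
    ((level lam m t - level lam m' t) *
      Real.exp (-((1 - Real.exp (-(2 * (t * l)))) / 4)))) with hh
  have hnn {t : ℝ} (ht : 0 ≤ t) : 0 ≤ h t := by
    have := sub_nonneg.2 (hanti ht)
    positivity
  have hint : IntegrableOn h (Set.Ioi 0) := by
    have hc := continuous_level (lam := lam) m
    have hc' := continuous_level (lam := lam) m'
    refine Integrable.mono' (integrableOn_exp_neg_Ioi 0)
      (Continuous.aestronglyMeasurable (by fun_prop)) ?_
    filter_upwards [ae_restrict_mem measurableSet_Ioi] with t ht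
    have ht' : 0 ≤ t := le_of_lt ht
    rw [Real.norm_of_nonneg (hnn ht')]
    have e1 : Real.exp (-(t * l)) ≤ 1 :=
      Real.exp_le_one_iff.2 (by have := mul_nonneg ht' hl0.le; linarith)
    have e2 : (level lam m t - level lam m' t) *
        Real.exp (-((1 - Real.exp (-(2 * (t * l)))) / 4)) ≤ 1 := by
      refine mul_le_one₀ ?_ (Real.exp_pos _).le (hexp1 ht')
      linarith [level_nonneg (lam := lam) m' t, hle1 ht']
    refine (mul_le_of_le_one_left ?_ e1).trans (mul_le_of_le_one_right (Real.exp_pos _).le e2)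
    have := sub_nonneg.2 (hanti ht')
    positivity
  have hsub : Set.Icc (1 / l) (2 / l) ⊆ Set.Ioi 0 := fun t ht =>
    (one_div_pos.2 hl0).trans_le ht.1
  have hlow : ∀ t ∈ Set.Icc (1 / l) (2 / l),
      Real.exp (-2) * (Real.exp (-1) * (1 / 2 * Real.exp (-(1 / 4)))) ≤ h t := by
    intro t ht
    have e1 : t * l ≤ 2 := (le_div_iff₀ hl0).1 ht.2
    have e2 : t ≤ 1 := ht.2.trans ((div_le_one hl0).2 hl)
    have e3 : 1 / 2 ≤ level lam m t - level lam m' t := by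
      have := level_anti_right hpos m ht.2
      have := level_anti_right hpos m' ht.1
      linarith
    have e4 := Real.exp_pos (-(2 * (t * l)))
    simp only [hh]
    gcongr
    linarith
  have hvol : volume.real (Set.Icc (1 / l) (2 / l)) = 1 / l := by
    rw [Real.volume_real_Icc_of_le (by gcongr; norm_num)]
    ring
  have k1 := setIntegral_ge_of_const_le_real measurableSet_Icc (by simp) hlow
    (hint.mono_set hsub)
  have k2 := setIntegral_mono_set hint
    (by filter_upwards [ae_restrict_mem measurableSet_Ioi] with t ht using hnn (le_of_lt ht))
    hsub.eventuallyLE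
  rw [hvol] at k1
  calc _ = l * (Real.exp (-2) * (Real.exp (-1) * (1 / 2 * Real.exp (-(1 / 4)))) * (1 / l)) := by
        field_simp
    _ ≤ _ := by
        gcongr
        exact k1.trans k2

variable {H : Type*} [NormedAddCommGroup H] [InnerProductSpace ℝ H] [CompleteSpace H]
  [TopologicalSpace.SeparableSpace H] [MeasurableSpace H] [BorelSpace H]
  (e : HilbertBasis ℕ ℝ H) {lam : ℕ → ℝ}

omit [TopologicalSpace.SeparableSpace H] [MeasurableSpace H] [BorelSpace H] in
-- Domain membership is essential here: it ensures that the series defining (-A)^{1/2} x converges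
-- with the expected coordinates.
theorem sum_sq_le_norm_sqrtNegA_sq {x : H} (hx : x ∈ domSqrtNegA e lam) (s : Finset ℕ) :
    ∑ k ∈ s, (√(lam k) * ⟪e k, x⟫) ^ 2 ≤ ‖sqrtNegA e lam x‖ ^ 2 := by
  refine le_of_eq_of_le (Finset.sum_congr rfl fun k _ => ?_)
    (sum_le_hasSum s (fun k _ => sq_nonneg _) (hasSum_inner_basis_sq e (sqrtNegA e lam x)))
  rw [sqrtNegA, specFun, inner_basis_tsum e hx]
  simp only [neg_neg]

theorem sqrt_mul_inner_gradient_testFun (hpos : ∀ k, 0 < lam k)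
    (hsum : Summable fun k => 1 / lam k) {m κ : ℕ → ℕ} (hκ : StrictMono κ)
    (hodd : ∀ j i, κ j ≠ 2 * i) {n j : ℕ} (hj : j < n) :
    √(lam (κ j)) * ⟪e (κ j), gradient (resolventOne e lam (testFun e lam m κ n)) 0⟫ =
      lam (κ j) * ∫ t in Set.Ioi (0 : ℝ), Real.exp (-(t * lam (κ j))) * (Real.exp (-t) *
        ((level lam (m j) t - level lam (m (j + 1)) t) *
          Real.exp (-((1 - Real.exp (-(2 * (t * lam (κ j))))) / 4)))) := by
  have := isProbabilityMeasure_gaussianMeasure e hsum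
  have := UniformSpace.secondCountable_of_separable H
  have hf := isCbTwo_testFun e lam m κ n
  set k := κ j with hk
  have hmean {t : ℝ} (ht : 0 ≤ t) : ⟪e k, meanGradient e hpos (testFun e lam m κ n) t 0⟫
      = √(lam k) * ((level lam (m j) t - level lam (m (j + 1)) t) *
          Real.exp (-((1 - Real.exp (-(2 * (t * lam k)))) / 4))) := by
    rw [inner_basis_meanGradient e hpos hf]
    simp only [map_zero, zero_add, hk, fderiv_testFun_apply e lam hκ hodd hj]
    rw [integral_const_mul]
    congr 1
    have hint (i : ℕ) : Integrable (fun y => cutoff e lam i (sqrtCLM lam e t y) *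
        Real.cos (√(lam k) * ⟪e k, sqrtCLM lam e t y⟫)) (gaussianMeasure e lam) := by
      have h1 := (isCbTwo_cutoff e lam i).mul (isCbTwo_cos_mul_inner (√(lam k)) (e k))
      obtain ⟨C, hC⟩ := h1.bounded
      exact Integrable.of_bound (h1.contDiff.continuous.comp
        (sqrtCLM lam e t).continuous).aestronglyMeasurable C (ae_of_all _ fun y => hC _)
    simp only [sub_mul]
    rw [integral_sub (hint _) (hint _), integral_cutoff_mul_cos e hpos hsum ht (hodd j),
      integral_cutoff_mul_cos e hpos hsum ht (hodd j)]
  rw [inner_basis_gradient_resolventOne e hpos hf, ← integral_const_mul, ← integral_const_mul]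
  refine setIntegral_congr_fun measurableSet_Ioi fun t ht => ?_
  simp only [hmean (le_of_lt ht)]
  -- The prefactor λ_k on the right splits into one √λ_k from (-A)^{1/2} and one from
  -- differentiating the sine.
  nth_rw 5 [← Real.mul_self_sqrt (hpos k).le]
  ring

theorem exists_le_norm_sqrtNegA_gradient (hmono : StrictMono lam) (hpos : ∀ k, 0 < lam k)
    (hsum : Summable fun k => 1 / lam k) (htop : Tendsto lam atTop atTop) (r : ℝ) :
    ∃ f : H → ℝ, IsCbTwo f ∧ (∀ x, |f x| ≤ 1) ∧
      r ≤ ‖sqrtNegA e lam (gradient (resolventOne e lam f) 0)‖ := by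
  have := isProbabilityMeasure_gaussianMeasure e hsum
  obtain ⟨m, κ, hm0, hm, hκ, hj⟩ := exists_scales hpos hmono htop
  set c := Real.exp (-2) * (Real.exp (-1) * (1 / 2 * Real.exp (-(1 / 4)))) with hc
  have hc0 : 0 < c := by positivity
  -- With n orthogonal coordinates of size at least c, the squared norm is at least n c² ≥ r².
  obtain ⟨n, hn⟩ := exists_nat_ge (r ^ 2 / c ^ 2)
  have hf := isCbTwo_testFun e lam m κ n
  refine ⟨testFun e lam m κ n, hf, abs_testFun_le_one e lam hm0 hm κ n, ?_⟩
  refine le_of_sq_le_sq ?_ (norm_nonneg _)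
  calc r ^ 2 ≤ n * c ^ 2 := (div_le_iff₀ (by positivity)).1 hn
    _ = ∑ j ∈ Finset.range n, c ^ 2 := by simp
    _ ≤ ∑ j ∈ Finset.range n, (√(lam (κ j)) *
        ⟪e (κ j), gradient (resolventOne e lam (testFun e lam m κ n)) 0⟫) ^ 2 := by
        refine Finset.sum_le_sum fun j hjn => ?_
        rw [sqrt_mul_inner_gradient_testFun e hpos hsum hκ (fun j => (hj j).1)
          (Finset.mem_range.1 hjn)]
        obtain ⟨-, h1, h2, h3⟩ := hj j
        have := mul_level_sub_le_integral hpos (hm j.le_succ) h1 h2 h3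
        gcongr
    _ = ∑ k ∈ (Finset.range n).image κ, (√(lam k) *
        ⟪e k, gradient (resolventOne e lam (testFun e lam m κ n)) 0⟫) ^ 2 := by
        rw [Finset.sum_image hκ.injective.injOn]
    _ ≤ _ := sum_sq_le_norm_sqrtNegA_sq e
        (gradient_resolventOne_mem_domSqrtNegA e hpos hf 0) _

end LowerBound

end

end OUSemigroup

theorem mainTheorem2 {H : Type*} [NormedAddCommGroup H] [InnerProductSpace ℝ H] [CompleteSpace H]
    [TopologicalSpace.SeparableSpace H] [MeasurableSpace H] [BorelSpace H]
    -- `e k` and `lam k` stand for `e_{k+1}` and `λ_{k+1}`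
    (e : HilbertBasis ℕ ℝ H) (lam : ℕ → ℝ) (hmono : StrictMono lam) (hpos : ∀ k, 0 < lam k)
    (hlam : lam ~[atTop] fun k : ℕ => ((k : ℝ) + 1) ^ 2) :
    -- for `f ∈ C²_b(H)` the function `R(1, L) f` is differentiable, its gradient lies in the
    -- domain of `(-A)^{1/2}`
    (∀ f : H → ℝ, OUSemigroup.IsCbTwo f →
      Differentiable ℝ (OUSemigroup.resolventOne e lam f) ∧
      ∀ x, gradient (OUSemigroup.resolventOne e lam f) x ∈ OUSemigroup.domSqrtNegA e lam) ∧
    (⨆ (f : H → ℝ) (_ : OUSemigroup.IsCbTwo f) (_ : ∀ x, |f x| ≤ 1),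
      ‖OUSemigroup.sqrtNegA e lam (gradient (OUSemigroup.resolventOne e lam f) 0)‖ₑ) = ∞ ∧
    ¬ ∃ C : ℝ, 0 < C ∧ ∀ f : H → ℝ, OUSemigroup.IsCbTwo f →
      ∀ x, ‖OUSemigroup.sqrtNegA e lam (gradient (OUSemigroup.resolventOne e lam f) x)‖
        ≤ C * ⨆ y, |f y| := by
  have hsum := OUSemigroup.summable_one_div_of_isEquivalent_sq hlam
  have htop := OUSemigroup.tendsto_atTop_of_isEquivalent_sq hlam
  have := OUSemigroup.isProbabilityMeasure_gaussianMeasure e hsum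
  refine ⟨fun f hf => ⟨fun x =>
    (OUSemigroup.hasGradientAt_resolventOne e hpos hf x).differentiableAt,
    OUSemigroup.gradient_resolventOne_mem_domSqrtNegA e hpos hf⟩, ?_, ?_⟩
  · refine ENNReal.eq_top_of_forall_nnreal_le fun r => ?_
    obtain ⟨f, hf, hf1, hr⟩ :=
      OUSemigroup.exists_le_norm_sqrtNegA_gradient e hmono hpos hsum htop r
    refine le_iSup_of_le f (le_iSup_of_le hf (le_iSup_of_le hf1 ?_))
    rw [enorm_eq_nnnorm, ENNReal.coe_le_coe]
    exact hr
  · rintro ⟨C, hC, h⟩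
    obtain ⟨f, hf, hf1, hr⟩ :=
      OUSemigroup.exists_le_norm_sqrtNegA_gradient e hmono hpos hsum htop (C + 1)
    have h1 : ⨆ y, |f y| ≤ 1 := ciSup_le hf1
    have h2 := mul_le_mul_of_nonneg_left h1 hC.le
    linarith [h f hf 0]
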